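/- Let $K$ be a field of characteristic $0$ and let $(\mathcal A,A,A')$ be a quasi-twilled associative algebra over $K$: $\mathcal A$ is an associative (not necessarily unital) $K$-algebra with a decomposition $\mathcal A=A\oplus A'$ into subspaces such that $A'$ is a subalgebra. Write the multiplication of $\mathcal A$ as $\Omega=\pi+\xi+\eta+\beta+\rho+\mu+\theta$, that is, for $x,y\in A$ and $u,v\in A'$, $$(x+u)(y+v)=\big(\pi(x,y)+\xi(x,v)+\eta(u,y)\big)+\big(\beta(u,v)+\rho(x,v)+\mu(u,y)+\theta(x,y)\big),$$ where the first bracket lies in $A$ and the second in $A'$. A linear map $B:A'\to A$ is a left deformation map if for all $u,v\in A'$ $$\pi(Bu,Bv)+\xi(Bu,v)+\eta(u,Bv)=B\big(\beta(u,v)+\rho(Bu,v)+\mu(u,Bv)+\theta(Bu,Bv)\big).$$ Let $[\cdot,\cdot]_G$ be the Gerstenhaber bracket on $\bigoplus_{n\ge 0}\mathrm{Hom}(\otimes^{n+1}\mathcal A,\mathcal A)$ (elements of $\mathrm{Hom}(\otimes^{n+1}\mathcal A,\mathcal A)$ have degree $n$). Regard the components of $\Omega$, and the elements of $F=\bigoplus_{n\ge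 0}\mathrm{Hom}(\otimes^{n+1}A',A)$, as cochains on $\mathcal A$ by extending them by zero. Let $F$ carry the operations $$l_1(f)=[\xi+\eta+\beta,f]_G,\qquad l_2(f_1,f_2)=[[\pi+\rho+\mu,f_1]_G,f_2]_G,\qquad l_3(f_1,f_2,f_3)=[[[\theta,f_1]_G,f_2]_G,f_3]_G,$$ and $l_k=0$ for all other $k$. Let $B:A'\to A$ be a left deformation map, regarded as a degree $0$ element of $F$, and let $l_k^B(f_1,\dots,f_k)=\sum_{n\ge0}\frac1{n!}\,l_{k+n}(B,\dots,B,f_1,\dots,f_k)$, $k\ge 1$, be the operations twisted by $B$, that is, $$l_1^B(f)=l_1(f)+l_2(B,f)+\tfrac12 l_3(B,B,f),\quad l_2^B(f_1,f_2)=l_2(f_1,f_2)+l_3(B,f_1,f_2),\quad l_3^B=l_3,\quad l_k^B=0\ (k\ge4).$$ Let $B':A'\to A$ be a linear map. Then $B+B'$ is a left deformation map of $(\mathcal A,A,A')$ if and only if $B'$ is a Maurer–Cartan element of the twisted $L_\infty$-algebra $(F,l_1^B,l_2^B,l_3^B)$, i.e. the degree $0$ element $B'$ satisfies $$\sum_{k\ge1}\frac1{k!}\,l_k^B(B',\dots,B')=0.$$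 -/

import Mathlib

open scoped DirectSum

noncomputable section

/-! ## Consecutive entries of a list -/

section Lists

variable {V : Type*}

/-- The `n + 1` consecutive entries `x_i, …, x_{i+n}` of a list of length `m + n + 1`. -/
def window {m : ℕ} (n : ℕ) (i : Fin (m + 1)) (x : Fin (m + n + 1) → V) : Fin (n + 1) → V :=
  fun k => x ⟨i + k, by omega⟩

/-- The list `x_0, …, x_{i-1}, w, x_{i+n+1}, …, x_{m+n}` of length `m + 1`. -/
def contract {m : ℕ} (n : ℕ) (i : Fin (m + 1)) (w : V) (x : Fin (m + n + 1) → V) :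
    Fin (m + 1) → V :=
  fun j => if j < i then x ⟨j, by omega⟩ else if j = i then w else x ⟨j + n, by omega⟩

theorem window_update_of_notMem {m n : ℕ} (i : Fin (m + 1)) (x : Fin (m + n + 1) → V)
    (t : Fin (m + n + 1)) (a : V) (h : (t : ℕ) < i ∨ (i : ℕ) + n < t) :
    window n i (Function.update x t a) = window n i x := by
  funext k
  have : (⟨i + k, by omega⟩ : Fin (m + n + 1)) ≠ t := by
    rw [Ne, Fin.ext_iff]; simp only; omega
  simp [window, Function.update_of_ne this]

theorem window_update_of_mem {m n : ℕ} (i : Fin (m + 1)) (x : Fin (m + n + 1) → V)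
    (t : Fin (m + n + 1)) (a : V) (h : (i : ℕ) ≤ t) (h' : (t : ℕ) ≤ i + n) :
    window n i (Function.update x t a) =
      Function.update (window n i x) ⟨t - i, by omega⟩ a := by
  funext k
  simp only [window, Function.update_apply, Fin.ext_iff]
  grind

theorem contract_update_of_lt {m n : ℕ} (i : Fin (m + 1)) (w : V) (x : Fin (m + n + 1) → V)
    (t : Fin (m + n + 1)) (a : V) (h : (t : ℕ) < i) :
    contract n i w (Function.update x t a) =
      Function.update (contract n i w x) ⟨t, by omega⟩ a := by
  funext j
  simp only [contract, Function.update_apply, Fin.ext_iff, Fin.lt_def]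
  grind

theorem contract_update_of_gt {m n : ℕ} (i : Fin (m + 1)) (w : V) (x : Fin (m + n + 1) → V)
    (t : Fin (m + n + 1)) (a : V) (h : (i : ℕ) + n < t) :
    contract n i w (Function.update x t a) =
      Function.update (contract n i w x) ⟨t - n, by omega⟩ a := by
  funext j
  simp only [contract, Function.update_apply, Fin.ext_iff, Fin.lt_def]
  grind

theorem contract_update_of_mem {m n : ℕ} (i : Fin (m + 1)) (w : V) (x : Fin (m + n + 1) → V)
    (t : Fin (m + n + 1)) (a w₀ : V) (h : (i : ℕ) ≤ t) (h' : (t : ℕ) ≤ i + n) :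
    contract n i w (Function.update x t a) = Function.update (contract n i w₀ x) i w := by
  funext j
  simp only [contract, Function.update_apply, Fin.ext_iff, Fin.lt_def]
  grind

theorem contract_eq_update {m n : ℕ} (i : Fin (m + 1)) (w w₀ : V) (x : Fin (m + n + 1) → V) :
    contract n i w x = Function.update (contract n i w₀ x) i w := by
  funext j
  simp only [contract, Function.update_apply, Fin.ext_iff, Fin.lt_def]
  grind

end Lists

/-! ## Cochains and the Gerstenhaber bracket -/

section Cochains

variable (K : Type*) [Field K]

/-- Cochains of degree `n`: linear maps `⊗^{n+1} V → W`, encoded as multilinear maps. -/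
abbrev Cochain (V W : Type*) [AddCommGroup V] [Module K V] [AddCommGroup W] [Module K W] (n : ℕ) :
    Type _ :=
  MultilinearMap K (fun _ : Fin (n + 1) => V) W

/-- The graded vector space `⊕_{n ≥ 0} Hom(⊗^{n+1} V, W)`; the `n`-th summand has degree `n`. -/
abbrev Cochains (V W : Type*) [AddCommGroup V] [Module K V] [AddCommGroup W] [Module K W] :
    Type _ :=
  ⨁ n : ℕ, Cochain K V W n

variable {K}
variable {V W V' W' : Type*} [AddCommGroup V] [Module K V] [AddCommGroup W] [Module K W]
  [AddCommGroup V'] [Module K V'] [AddCommGroup W'] [Module K W']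

/-- A linear map, seen as an element of degree `0` of `⊕_{n ≥ 0} Hom(⊗^{n+1} V, W)`. -/
def ofLinear (f : V →ₗ[K] W) : Cochains K V W :=
  DirectSum.lof K ℕ (fun n => Cochain K V W n) 0 (MultilinearMap.ofSubsingleton K V W (0 : Fin 1) f)

/-- A bilinear map, seen as a cochain of degree `1`. -/
def bilinCochain (f : V →ₗ[K] V →ₗ[K] W) : Cochain K V W 1 where
  toFun x := f (x 0) (x 1)
  map_update_add' {inst} x t a b := by
    cases Subsingleton.elim inst (instDecidableEqFin _)
    fin_cases t <;> simp
  map_update_smul' {inst} x t c a := by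
    cases Subsingleton.elim inst (instDecidableEqFin _)
    fin_cases t <;> simp

/-- A bilinear map, seen as an element of degree `1` of `⊕_{n ≥ 0} Hom(⊗^{n+1} V, W)`. -/
def ofBilin (f : V →ₗ[K] V →ₗ[K] W) : Cochains K V W :=
  DirectSum.lof K ℕ (fun n => Cochain K V W n) 1 (bilinCochain f)

/-- The linear map `c ↦ q ∘ c ∘ (p ⊗ ⋯ ⊗ p)` on the graded vector space of cochains. -/
def conjCochains (p : V' →ₗ[K] V) (q : W →ₗ[K] W') : Cochains K V W →ₗ[K] Cochains K V' W' :=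
  DirectSum.lmap fun n =>
    { toFun := fun c : Cochain K V W n => q.compMultilinearMap (c.compLinearMap fun _ => p)
      map_add' := fun _ _ => by ext; simp
      map_smul' := fun _ _ => by ext; simp }

/-- Insertion of `g` in the `i`-th slot of `f`:
`(x_0, …, x_{m+n}) ↦ f (x_0, …, x_{i-1}, g (x_i, …, x_{i+n}), x_{i+n+1}, …, x_{m+n})`. -/
def insertAt {m n : ℕ} (f : Cochain K V V m) (g : Cochain K V V n) (i : Fin (m + 1)) :
    Cochain K V V (m + n) where
  toFun x := f (contract n i (g (window n i x)) x)
  map_update_add' {inst} x t a b := by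
    cases Subsingleton.elim inst (instDecidableEqFin _)
    rcases lt_or_ge (t : ℕ) i with h | h
    · simp only [window_update_of_notMem i x t _ (Or.inl h), contract_update_of_lt i _ x t _ h,
        MultilinearMap.map_update_add]
    rcases lt_or_ge ((i : ℕ) + n) t with h' | h'
    · simp only [window_update_of_notMem i x t _ (Or.inr h'), contract_update_of_gt i _ x t _ h',
        MultilinearMap.map_update_add]
    · simp only [window_update_of_mem i x t _ h h', contract_update_of_mem i _ x t _ 0 h h',
        MultilinearMap.map_update_add]
  map_update_smul' {inst} x t c a := by
    cases Subsingleton.elim inst (instDecidableEqFin _)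
    rcases lt_or_ge (t : ℕ) i with h | h
    · simp only [window_update_of_notMem i x t _ (Or.inl h), contract_update_of_lt i _ x t _ h,
        MultilinearMap.map_update_smul]
    rcases lt_or_ge ((i : ℕ) + n) t with h' | h'
    · simp only [window_update_of_notMem i x t _ (Or.inr h'), contract_update_of_gt i _ x t _ h',
        MultilinearMap.map_update_smul]
    · simp only [window_update_of_mem i x t _ h h', contract_update_of_mem i _ x t _ 0 h h',
        MultilinearMap.map_update_smul]

theorem map_contract_add {m n : ℕ} (f : Cochain K V V m) (i : Fin (m + 1)) (w w' : V)
    (x : Fin (m + n + 1) → V) :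
    f (contract n i (w + w') x) = f (contract n i w x) + f (contract n i w' x) := by
  rw [contract_eq_update i (w + w') 0, contract_eq_update i w 0, contract_eq_update i w' 0,
    MultilinearMap.map_update_add]

theorem map_contract_smul {m n : ℕ} (f : Cochain K V V m) (i : Fin (m + 1)) (c : K) (w : V)
    (x : Fin (m + n + 1) → V) :
    f (contract n i (c • w) x) = c • f (contract n i w x) := by
  rw [contract_eq_update i (c • w) 0, contract_eq_update i w 0, MultilinearMap.map_update_smul]

/-- The composition `f ∘ g = ∑_i (-1)^{i n} f (…, g (x_i, …, x_{i+n}), …)` of cochains of degrees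
`m` and `n` (`i` counts from `0`), bilinear in `f` and `g`. -/
def circ (m n : ℕ) : Cochain K V V m →ₗ[K] Cochain K V V n →ₗ[K] Cochain K V V (m + n) :=
  LinearMap.mk₂ K (fun f g => ∑ i : Fin (m + 1), (-1 : K) ^ ((i : ℕ) * n) • insertAt f g i)
    (fun f f' g => by
      ext x
      simp [insertAt, Finset.sum_add_distrib])
    (fun c f g => by
      ext x
      simp [insertAt, Finset.smul_sum, smul_comm c])
    (fun f g g' => by
      ext x
      simp [insertAt, map_contract_add, Finset.sum_add_distrib])
    (fun c f g => by
      ext x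
      simp [insertAt, map_contract_smul, Finset.smul_sum, smul_comm c])

/-- The composition `∘`, extended bilinearly to `⊕_{n ≥ 0} Hom(⊗^{n+1} V, V)`. -/
def circL : Cochains K V V →ₗ[K] Cochains K V V →ₗ[K] Cochains K V V :=
  DirectSum.toModule K ℕ _ fun m =>
    LinearMap.flip (DirectSum.toModule K ℕ (Cochain K V V m →ₗ[K] Cochains K V V) fun n =>
      ((circ m n).compr₂ (DirectSum.lof K ℕ (fun k => Cochain K V V k) (m + n))).flip)

/-- The opposite composition with its sign: `(f, g) ↦ (-1)^{mn} g ∘ f` for `f`, `g` of degrees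
`m`, `n`, extended bilinearly. -/
def circOpL : Cochains K V V →ₗ[K] Cochains K V V →ₗ[K] Cochains K V V :=
  DirectSum.toModule K ℕ _ fun m =>
    LinearMap.flip (DirectSum.toModule K ℕ (Cochain K V V m →ₗ[K] Cochains K V V) fun n =>
      (-1 : K) ^ (m * n) •
        (circ n m).compr₂ (DirectSum.lof K ℕ (fun k => Cochain K V V k) (n + m)))

/-- The Gerstenhaber bracket `[f, g] = f ∘ g - (-1)^{mn} g ∘ f` (`f`, `g` of degrees `m`, `n`). -/
def gerstenhaber : Cochains K V V →ₗ[K] Cochains K V V →ₗ[K] Cochains K V V :=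
  circL + (-1 : K) • circOpL

end Cochains

/-! ## Families of operations, Maurer–Cartan elements, twisting -/

section LInfinity

variable (K : Type*) [Field K]

/-- A family of multilinear operations `l_k : ⊗^k F → F`, `k ≥ 0`. -/
abbrev Operations (F : Type*) [AddCommGroup F] [Module K F] : Type _ :=
  ∀ k : ℕ, MultilinearMap K (fun _ : Fin k => F) F

variable {K}

/-- `x` is a Maurer–Cartan element for the operations `l_k` on the graded space `⊕ M n`: it has
degree `0` and `l_0 + ∑_{k ≥ 1} (1 / k!) l_k (x, …, x) = 0`. The sum is finite for every family of
operations that vanish from some arity on. -/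
def IsMaurerCartan {M : ℕ → Type*} [∀ n, AddCommGroup (M n)] [∀ n, Module K (M n)]
    (l : Operations K (⨁ n, M n)) (x : ⨁ n, M n) : Prop :=
  x ∈ LinearMap.range (DirectSum.lof K ℕ M 0) ∧
    ∑ᶠ k : ℕ, ((k.factorial : K)⁻¹) • l k (fun _ => x) = 0

variable {F : Type*} [AddCommGroup F] [Module K F]

/-- Filling the first `n` entries of an operation with `x`:
`(x_1, …, x_k) ↦ f (x, …, x, x_1, …, x_k)`. -/
def fillFirst (x : F) (k : ℕ) :
    ∀ n : ℕ, MultilinearMap K (fun _ : Fin (k + n) => F) F → MultilinearMap K (fun _ : Fin k => F) F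
  | 0, f => f
  | n + 1, f => fillFirst x k n (MultilinearMap.curryLeft (n := k + n) f x)

/-- The operations twisted by `x`:
`l_k^x (x_1, …, x_k) = ∑_{n ≥ 0} (1 / n!) l_{k+n} (x, …, x, x_1, …, x_k)` for `k ≥ 1`, and
`l_0^x = 0`. The sum is finite for operations that vanish from some arity on. -/
def twist (l : Operations K F) (x : F) : Operations K F
  | 0 => 0
  | k + 1 => ∑ᶠ n : ℕ, ((n.factorial : K)⁻¹) • fillFirst x (k + 1) n (l (k + 1 + n))

end LInfinity

/-! ## Quasi-twilled associative algebras -/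

/-- A quasi-twilled associative algebra structure on an associative (not necessarily unital)
algebra `𝒜`: a decomposition `𝒜 = A ⊕ A'` into subspaces such that `A'` is a subalgebra. -/
structure QuasiTwilled (K 𝒜 : Type*) [Field K] [NonUnitalRing 𝒜] [Module K 𝒜] where
  /-- the subspace `A` -/
  A : Submodule K 𝒜
  /-- the subspace `A'` -/
  A' : Submodule K 𝒜
  isCompl : IsCompl A A'
  mul_mem : ∀ ⦃u v : 𝒜⦄, u ∈ A' → v ∈ A' → u * v ∈ A'

namespace QuasiTwilled

variable {K 𝒜 : Type*} [Field K] [NonUnitalRing 𝒜] [Module K 𝒜]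
variable (T : QuasiTwilled K 𝒜)

/-- The projection `𝒜 → A` along `A'`. -/
def pr : 𝒜 →ₗ[K] T.A := T.A.projectionOnto T.A' T.isCompl

/-- The projection `𝒜 → A'` along `A`. -/
def pr' : 𝒜 →ₗ[K] T.A' := T.A'.projectionOnto T.A T.isCompl.symm

/-- The lift `⊕ Hom(⊗^{n+1} A', A) → ⊕ Hom(⊗^{n+1} 𝒜, 𝒜)` (zero on all the other summands of
`⊗^{n+1} 𝒜`). -/
def lift : Cochains K T.A' T.A →ₗ[K] Cochains K 𝒜 𝒜 := conjCochains T.pr' T.A.subtype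

/-- The projection `P : ⊕ Hom(⊗^{n+1} 𝒜, 𝒜) → ⊕ Hom(⊗^{n+1} A', A)`, a left inverse of the
lift. -/
def proj : Cochains K 𝒜 𝒜 →ₗ[K] Cochains K T.A' T.A := conjCochains T.A'.subtype T.pr

/-- The iterated bracket `(f_1, …, f_k) ↦ [⋯[[Δ, f_1], f_2], ⋯, f_k]` with the lifts of
`f_i ∈ ⊕ Hom(⊗^{n+1} A', A)`, linear in `Δ` and multilinear in the `f_i`. -/
def iteratedBracket : ∀ k : ℕ, Cochains K 𝒜 𝒜 →ₗ[K]
    MultilinearMap K (fun _ : Fin k => Cochains K T.A' T.A) (Cochains K 𝒜 𝒜)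
  | 0 => (MultilinearMap.constLinearEquivOfIsEmpty K K _ _).toLinearMap
  | k + 1 => (multilinearCurryLeftEquiv K (fun _ : Fin (k + 1) => Cochains K T.A' T.A)
      (Cochains K 𝒜 𝒜)).symm.toLinearMap ∘ₗ
        (gerstenhaber.compl₂ T.lift).compr₂ (iteratedBracket k)

variable [IsScalarTower K 𝒜 𝒜] [SMulCommClass K 𝒜 𝒜]

/-! The components of the multiplication: for `x, y ∈ A` and `u, v ∈ A'`,
`(x + u) (y + v) = (π x y + ξ x v + η u y) + (β u v + ρ x v + μ u y + θ x y)`. -/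

/-- The component `A ⊗ A → A`. -/
def π : T.A →ₗ[K] T.A →ₗ[K] T.A :=
  ((LinearMap.mul K 𝒜).compl₁₂ T.A.subtype T.A.subtype).compr₂ T.pr

/-- The component `A ⊗ A' → A`. -/
def ξ : T.A →ₗ[K] T.A' →ₗ[K] T.A :=
  ((LinearMap.mul K 𝒜).compl₁₂ T.A.subtype T.A'.subtype).compr₂ T.pr

/-- The component `A' ⊗ A → A`. -/
def η : T.A' →ₗ[K] T.A →ₗ[K] T.A :=
  ((LinearMap.mul K 𝒜).compl₁₂ T.A'.subtype T.A.subtype).compr₂ T.pr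

/-- The component `A' ⊗ A' → A'`. -/
def β : T.A' →ₗ[K] T.A' →ₗ[K] T.A' :=
  ((LinearMap.mul K 𝒜).compl₁₂ T.A'.subtype T.A'.subtype).compr₂ T.pr'

/-- The component `A ⊗ A' → A'`. -/
def ρ : T.A →ₗ[K] T.A' →ₗ[K] T.A' :=
  ((LinearMap.mul K 𝒜).compl₁₂ T.A.subtype T.A'.subtype).compr₂ T.pr'

/-- The component `A' ⊗ A → A'`. -/
def μ : T.A' →ₗ[K] T.A →ₗ[K] T.A' :=
  ((LinearMap.mul K 𝒜).compl₁₂ T.A'.subtype T.A.subtype).compr₂ T.pr'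

/-- The component `A ⊗ A → A'`. -/
def θ : T.A →ₗ[K] T.A →ₗ[K] T.A' :=
  ((LinearMap.mul K 𝒜).compl₁₂ T.A.subtype T.A.subtype).compr₂ T.pr'

/-- Left deformation maps `B : A' → A`. -/
def IsLeftDeformationMap (B : T.A' →ₗ[K] T.A) : Prop :=
  ∀ u v : T.A',
    T.π (B u) (B v) + T.ξ (B u) v + T.η u (B v) =
      B (T.β u v + T.ρ (B u) v + T.μ u (B v) + T.θ (B u) (B v))

/-! The lifts of the components to cochains on `𝒜` (zero on all the other summands of
`𝒜 ⊗ 𝒜`), as elements of degree `1` of `⊕_{n ≥ 0} Hom(⊗^{n+1} 𝒜, 𝒜)`. -/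

/-- The lift of `π`. -/
def πL : Cochains K 𝒜 𝒜 := ofBilin ((T.π.compl₁₂ T.pr T.pr).compr₂ T.A.subtype)

/-- The lift of `ξ`. -/
def ξL : Cochains K 𝒜 𝒜 := ofBilin ((T.ξ.compl₁₂ T.pr T.pr').compr₂ T.A.subtype)

/-- The lift of `η`. -/
def ηL : Cochains K 𝒜 𝒜 := ofBilin ((T.η.compl₁₂ T.pr' T.pr).compr₂ T.A.subtype)

/-- The lift of `β`. -/
def βL : Cochains K 𝒜 𝒜 := ofBilin ((T.β.compl₁₂ T.pr' T.pr').compr₂ T.A'.subtype)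

/-- The lift of `ρ`. -/
def ρL : Cochains K 𝒜 𝒜 := ofBilin ((T.ρ.compl₁₂ T.pr T.pr').compr₂ T.A'.subtype)

/-- The lift of `μ`. -/
def μL : Cochains K 𝒜 𝒜 := ofBilin ((T.μ.compl₁₂ T.pr' T.pr).compr₂ T.A'.subtype)

/-- The lift of `θ`. -/
def θL : Cochains K 𝒜 𝒜 := ofBilin ((T.θ.compl₁₂ T.pr T.pr).compr₂ T.A'.subtype)

/-- The operations on `⊕_{n ≥ 0} Hom(⊗^{n+1} A', A)`:
`l_1 f = [ξ + η + β, f]`, `l_2 (f_1, f_2) = [[π + ρ + μ, f_1], f_2]`,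
`l_3 (f_1, f_2, f_3) = [[[θ, f_1], f_2], f_3]`, and `l_k = 0` otherwise. The brackets are taken in
`⊕ Hom(⊗^{n+1} 𝒜, 𝒜)`; they lie in the image of the lift, and `proj` reads them as elements of
`⊕ Hom(⊗^{n+1} A', A)`. -/
def l : Operations K (Cochains K T.A' T.A)
  | 1 => T.proj.compMultilinearMap (T.iteratedBracket 1 (T.ξL + T.ηL + T.βL))
  | 2 => T.proj.compMultilinearMap (T.iteratedBracket 2 (T.πL + T.ρL + T.μL))
  | 3 => T.proj.compMultilinearMap (T.iteratedBracket 3 T.θL)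
  | _ => 0

end QuasiTwilled

end

/-! For a linear map `f : A' → A`, let Φ(f) be the bilinear map whose value at `(u, v)` is the left
side of the deformation equation minus the right side. It is a cubic polynomial in `f` without
constant term. Its linear, quadratic and cubic parts are `lOne f`, `(1/2) lTwo f f` and `(1/6)
lThree f f f`, where `lTwo` and `lThree` are symmetric. Twisting by `B` is Taylor expansion at `B`,
so the Maurer–Cartan expression of `B'` for the twisted operations is Φ(B + B') − Φ(B). As Φ(B) = 0,
its vanishing is that of Φ(B + B'). All arguments have degree `0`, so no signs survive and every
bracket is a bilinear map, given by `gerstenhaber_ofBilin_ofLinear`. The lemmas `l_one_ofLinear`,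
`l_two_ofLinear` and `l_three_ofLinear` identify the operations with the polarised parts of Φ;
`finsum_twist` assembles them. -/

noncomputable section

/-! ### Gerstenhaber brackets of a bilinear map with a linear map -/

section Cochains

variable {K : Type*} [Field K] {V W V' W' : Type*} [AddCommGroup V] [Module K V] [AddCommGroup W]
  [Module K W] [AddCommGroup V'] [Module K V'] [AddCommGroup W'] [Module K W']

/-- The bracket `(x, y) ↦ D (f x) y + D x (f y) - f (D x y)` of a bilinear and a linear map. -/
def bilinBracket (D : V →ₗ[K] V →ₗ[K] V) (f : V →ₗ[K] V) : V →ₗ[K] V →ₗ[K] V :=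
  D.compl₁₂ f LinearMap.id + D.compl₁₂ LinearMap.id f - D.compr₂ f

@[simp] theorem bilinBracket_apply (D : V →ₗ[K] V →ₗ[K] V) (f : V →ₗ[K] V) (x y : V) :
    bilinBracket D f x y = D (f x) y + D x (f y) - f (D x y) := rfl

theorem ofBilin_add (D E : V →ₗ[K] V →ₗ[K] W) : ofBilin (D + E) = ofBilin D + ofBilin E := by
  rw [ofBilin, ofBilin, ofBilin, ← map_add]
  rfl

theorem ofBilin_smul (c : K) (D : V →ₗ[K] V →ₗ[K] W) : ofBilin (c • D) = c • ofBilin D := by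
  rw [ofBilin, ofBilin, ← map_smul]
  rfl

theorem ofBilin_eq_zero_iff (D : V →ₗ[K] V →ₗ[K] W) : ofBilin D = 0 ↔ ∀ x y, D x y = 0 := by
  constructor
  · intro h x y
    have h' : bilinCochain D = 0 := by
      apply DFinsupp.single_injective (i := 1) (β := fun n => Cochain K V W n)
      exact h.trans (map_zero (DirectSum.lof K ℕ (fun n => Cochain K V W n) 1)).symm
    exact congrArg (fun c : Cochain K V W 1 => c ![x, y]) h'
  · intro h
    have h' : D = 0 := by ext x y; exact h x y
    simpa [h'] using ofBilin_smul (0 : K) D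

theorem conjCochains_ofLinear (p : V' →ₗ[K] V) (q : W →ₗ[K] W') (f : V →ₗ[K] W) :
    conjCochains p q (ofLinear f) = ofLinear (q ∘ₗ f ∘ₗ p) := by
  rw [conjCochains, ofLinear, ofLinear, DirectSum.lmap_lof]
  rfl

theorem conjCochains_ofBilin (p : V' →ₗ[K] V) (q : W →ₗ[K] W') (D : V →ₗ[K] V →ₗ[K] W) :
    conjCochains p q (ofBilin D) = ofBilin ((D.compl₁₂ p p).compr₂ q) := by
  rw [conjCochains, ofBilin, ofBilin, DirectSum.lmap_lof]
  rfl

theorem circ_bilinCochain_ofSubsingleton (D : V →ₗ[K] V →ₗ[K] V) (f : V →ₗ[K] V) :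
    circ 1 0 (bilinCochain D) (MultilinearMap.ofSubsingleton K V V (0 : Fin 1) f) =
      bilinCochain (D.compl₁₂ f LinearMap.id + D.compl₁₂ LinearMap.id f) := by
  ext x
  simp [circ, insertAt, bilinCochain, window, contract, Fin.sum_univ_two]

theorem circ_ofSubsingleton_bilinCochain (D : V →ₗ[K] V →ₗ[K] V) (f : V →ₗ[K] V) :
    circ 0 1 (MultilinearMap.ofSubsingleton K V V (0 : Fin 1) f) (bilinCochain D) =
      bilinCochain (D.compr₂ f) := by
  ext x
  simp [circ, insertAt, bilinCochain, window, contract]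

theorem circL_ofBilin_ofLinear (D : V →ₗ[K] V →ₗ[K] V) (f : V →ₗ[K] V) :
    circL (ofBilin D) (ofLinear f) =
      ofBilin (D.compl₁₂ f LinearMap.id + D.compl₁₂ LinearMap.id f) := by
  rw [ofBilin, ofBilin, ← circ_bilinCochain_ofSubsingleton]
  simp only [circL, ofLinear, DirectSum.toModule_lof, LinearMap.flip_apply, LinearMap.compr₂_apply]

theorem circOpL_ofBilin_ofLinear (D : V →ₗ[K] V →ₗ[K] V) (f : V →ₗ[K] V) :
    circOpL (ofBilin D) (ofLinear f) = ofBilin (D.compr₂ f) := by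
  rw [ofBilin, ofBilin, ← circ_ofSubsingleton_bilinCochain]
  simp only [circOpL, ofLinear, DirectSum.toModule_lof, LinearMap.flip_apply, LinearMap.compr₂_apply,
    mul_zero, pow_zero, one_smul]

/-- Every sign exponent that occurs is a multiple of the degree `0` of `f` or of the slot index `0`,
so all signs are `1`. The result is again of this bilinear form, so the formula iterates. -/
theorem gerstenhaber_ofBilin_ofLinear (D : V →ₗ[K] V →ₗ[K] V) (f : V →ₗ[K] V) :
    gerstenhaber (ofBilin D) (ofLinear f) = ofBilin (bilinBracket D f) := by
  rw [gerstenhaber, LinearMap.add_apply, LinearMap.add_apply, LinearMap.smul_apply,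
    LinearMap.smul_apply, circL_ofBilin_ofLinear, circOpL_ofBilin_ofLinear, ← ofBilin_smul,
    ← ofBilin_add]
  congr 1
  ext x y
  simp [sub_eq_add_neg]

end Cochains

/-! ### The operations on degree `0` elements -/

namespace QuasiTwilled

variable {K 𝒜 : Type*} [Field K] [NonUnitalRing 𝒜] [Module K 𝒜] (T : QuasiTwilled K 𝒜)

@[simp] theorem pr_coe (a : T.A) : T.pr a = a := Submodule.projectionOnto_apply_left _ a

@[simp] theorem pr_coe' (a : T.A') : T.pr a = 0 := Submodule.projectionOnto_apply_right _ a

@[simp] theorem pr'_coe' (a : T.A') : T.pr' a = a := Submodule.projectionOnto_apply_left _ a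

@[simp] theorem pr'_coe (a : T.A) : T.pr' a = 0 := Submodule.projectionOnto_apply_right _ a

/-- The extension by zero of a linear map `A' → A` to `𝒜`. -/
def extend (f : T.A' →ₗ[K] T.A) : 𝒜 →ₗ[K] 𝒜 := T.A.subtype ∘ₗ f ∘ₗ T.pr'

@[simp] theorem extend_apply (f : T.A' →ₗ[K] T.A) (x : 𝒜) : T.extend f x = f (T.pr' x) := rfl

theorem lift_ofLinear (f : T.A' →ₗ[K] T.A) : T.lift (ofLinear f) = ofLinear (T.extend f) :=
  conjCochains_ofLinear _ _ f

theorem iteratedBracket_zero_apply (Δ : Cochains K 𝒜 𝒜) (x : Fin 0 → Cochains K T.A' T.A) :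
    T.iteratedBracket 0 Δ x = Δ := rfl

theorem iteratedBracket_succ_apply (k : ℕ) (Δ : Cochains K 𝒜 𝒜)
    (x : Fin (k + 1) → Cochains K T.A' T.A) : T.iteratedBracket (k + 1) Δ x =
      T.iteratedBracket k (gerstenhaber Δ (T.lift (x 0))) (Fin.tail x) := rfl

variable [IsScalarTower K 𝒜 𝒜] [SMulCommClass K 𝒜 𝒜]

theorem l_one_apply (x : Fin 1 → Cochains K T.A' T.A) :
    T.l 1 x = T.proj (gerstenhaber (T.ξL + T.ηL + T.βL) (T.lift (x 0))) := by
  rw [l, LinearMap.compMultilinearMap_apply, iteratedBracket_succ_apply,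
    iteratedBracket_zero_apply]

theorem l_two_apply (x : Fin 2 → Cochains K T.A' T.A) :
    T.l 2 x = T.proj (gerstenhaber (gerstenhaber (T.πL + T.ρL + T.μL) (T.lift (x 0)))
      (T.lift (x 1))) := by
  rw [l, LinearMap.compMultilinearMap_apply, iteratedBracket_succ_apply,
    iteratedBracket_succ_apply, iteratedBracket_zero_apply]
  rfl

theorem l_three_apply (x : Fin 3 → Cochains K T.A' T.A) :
    T.l 3 x = T.proj (gerstenhaber (gerstenhaber (gerstenhaber T.θL (T.lift (x 0)))
      (T.lift (x 1))) (T.lift (x 2))) := by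
  rw [l, LinearMap.compMultilinearMap_apply, iteratedBracket_succ_apply,
    iteratedBracket_succ_apply, iteratedBracket_succ_apply, iteratedBracket_zero_apply]
  rfl

theorem l_eq_zero {k : ℕ} (hk : 4 ≤ k) : T.l k = 0 := by
  obtain ⟨k, rfl⟩ := Nat.exists_eq_add_of_le' hk
  rfl

/-- The bilinear map `l_1 (f)`. -/
def lOne (f : T.A' →ₗ[K] T.A) : T.A' →ₗ[K] T.A' →ₗ[K] T.A :=
  T.ξ.compl₁₂ f LinearMap.id + T.η.compl₁₂ LinearMap.id f - T.β.compr₂ f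

/-- The bilinear map `l_2 (f, g)`. -/
def lTwo (f g : T.A' →ₗ[K] T.A) : T.A' →ₗ[K] T.A' →ₗ[K] T.A :=
  T.π.compl₁₂ f g + T.π.compl₁₂ g f -
    ((T.ρ.compl₁₂ f LinearMap.id + T.μ.compl₁₂ LinearMap.id f).compr₂ g +
      (T.ρ.compl₁₂ g LinearMap.id + T.μ.compl₁₂ LinearMap.id g).compr₂ f)

/-- The bilinear map `l_3 (f, g, h)`. -/
def lThree (f g h : T.A' →ₗ[K] T.A) : T.A' →ₗ[K] T.A' →ₗ[K] T.A :=
  -((T.θ.compl₁₂ f g + T.θ.compl₁₂ g f).compr₂ h + (T.θ.compl₁₂ f h + T.θ.compl₁₂ h f).compr₂ g +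
    (T.θ.compl₁₂ g h + T.θ.compl₁₂ h g).compr₂ f)

/-- The tuple is fixed only through its entries, so that constant tuples and those built with
`Fin.cons` are both covered. -/
theorem l_one_ofLinear (x : Fin 1 → Cochains K T.A' T.A) (f : T.A' →ₗ[K] T.A)
    (h0 : x 0 = ofLinear f) : T.l 1 x = ofBilin (T.lOne f) := by
  rw [l_one_apply, h0, lift_ofLinear, ξL, ηL, βL, ← ofBilin_add, ← ofBilin_add,
    gerstenhaber_ofBilin_ofLinear, proj, conjCochains_ofBilin]
  congr 1
  ext u v
  simp [lOne]

/-- Extended maps factor through `pr'` and land in `A`, so any composite of two of them is zero. In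
the double bracket only the terms survive where `f` and `g` fill different places among the two
inputs and the output. -/
theorem l_two_ofLinear (x : Fin 2 → Cochains K T.A' T.A) (f g : T.A' →ₗ[K] T.A)
    (h0 : x 0 = ofLinear f) (h1 : x 1 = ofLinear g) : T.l 2 x = ofBilin (T.lTwo f g) := by
  rw [l_two_apply, h0, h1, lift_ofLinear, lift_ofLinear, πL, ρL, μL, ← ofBilin_add, ← ofBilin_add,
    gerstenhaber_ofBilin_ofLinear, gerstenhaber_ofBilin_ofLinear, proj, conjCochains_ofBilin]
  congr 1
  ext u v
  simp [lTwo]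
  abel

/-- `θ` takes two inputs from `A` and has its value in `A'`, so each of its three places must
receive exactly one of the maps. The six assignments remain, all with a minus sign from the map
applied to the output. -/
theorem l_three_ofLinear (x : Fin 3 → Cochains K T.A' T.A) (f g h : T.A' →ₗ[K] T.A)
    (h0 : x 0 = ofLinear f) (h1 : x 1 = ofLinear g) (h2 : x 2 = ofLinear h) :
    T.l 3 x = ofBilin (T.lThree f g h) := by
  rw [l_three_apply, h0, h1, h2, lift_ofLinear, lift_ofLinear, lift_ofLinear, θL,
    gerstenhaber_ofBilin_ofLinear, gerstenhaber_ofBilin_ofLinear, gerstenhaber_ofBilin_ofLinear,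
    proj, conjCochains_ofBilin]
  congr 1
  ext u v
  simp [lThree]
  abel

/-! ### The twisted operations and their Maurer–Cartan expression -/

theorem fillFirst_zero {F : Type*} [AddCommGroup F] [Module K F] (x : F) (k n : ℕ) :
    fillFirst x k n (0 : MultilinearMap K (fun _ : Fin (k + n) => F) F) = 0 := by
  induction n with
  | zero => rfl
  | succ n ih => exact ih

/-- Only arities up to `3` contribute, so `k + 1 + n ≤ 3`. The truncated bound `3 - k` also gives
the empty sum for `k ≥ 3`. -/
theorem twist_succ (x : Cochains K T.A' T.A) (k : ℕ) :
    twist T.l x (k + 1) = ∑ n ∈ Finset.range (3 - k),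
      ((n.factorial : K)⁻¹) • fillFirst x (k + 1) n (T.l (k + 1 + n)) := by
  refine finsum_eq_sum_of_support_subset _ fun n hn => ?_
  by_contra h
  have h4 : 4 ≤ k + 1 + n := by simp at h; omega
  simp [T.l_eq_zero h4, fillFirst_zero] at hn

theorem twist_one (B f : T.A' →ₗ[K] T.A) :
    twist T.l (ofLinear B) 1 (fun _ => ofLinear f) =
      ofBilin (T.lOne f + T.lTwo B f + (2⁻¹ : K) • T.lThree B B f) := by
  rw [twist_succ, ofBilin_add, ofBilin_add, ofBilin_smul,
    ← T.l_one_ofLinear (fun _ => ofLinear f) f rfl,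
    ← T.l_two_ofLinear (Fin.cons (ofLinear B) fun _ => ofLinear f) B f rfl rfl,
    ← T.l_three_ofLinear (Fin.cons (ofLinear B) (Fin.cons (ofLinear B) fun _ => ofLinear f))
      B B f rfl rfl rfl]
  simp [Finset.sum_range_succ, fillFirst]

theorem twist_two (B f : T.A' →ₗ[K] T.A) :
    twist T.l (ofLinear B) 2 (fun _ => ofLinear f) =
      ofBilin (T.lTwo f f + T.lThree B f f) := by
  rw [twist_succ, ofBilin_add,
    ← T.l_two_ofLinear (fun _ => ofLinear f) f f rfl rfl,
    ← T.l_three_ofLinear (Fin.cons (ofLinear B) fun _ => ofLinear f) B f f rfl rfl rfl]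
  simp [Finset.sum_range_succ, fillFirst]

theorem twist_three (B f : T.A' →ₗ[K] T.A) :
    twist T.l (ofLinear B) 3 (fun _ => ofLinear f) = ofBilin (T.lThree f f f) := by
  rw [twist_succ, ← T.l_three_ofLinear (fun _ => ofLinear f) f f f rfl rfl rfl]
  simp [fillFirst]

theorem twist_eq_zero (x : Cochains K T.A' T.A) {k : ℕ} (hk : 4 ≤ k) : twist T.l x k = 0 := by
  obtain ⟨k, rfl⟩ := Nat.exists_eq_add_of_le' hk
  rw [twist_succ, Nat.sub_eq_zero_of_le (by omega), Finset.range_zero, Finset.sum_empty]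

/-- The left-hand side of the Maurer–Cartan equation of the twisted operations. -/
theorem finsum_twist (B f : T.A' →ₗ[K] T.A) :
    ∑ᶠ k : ℕ, ((k.factorial : K)⁻¹) • twist T.l (ofLinear B) k (fun _ => ofLinear f) =
      ofBilin (T.lOne f + T.lTwo B f + (2⁻¹ : K) • T.lThree B B f +
        (2⁻¹ : K) • (T.lTwo f f + T.lThree B f f) + (6⁻¹ : K) • T.lThree f f f) := by
  rw [finsum_eq_sum_of_support_subset (s := Finset.range 4)]
  · have h0 : twist T.l (ofLinear B) 0 = 0 := rfl
    simp only [Finset.sum_range_succ, Finset.sum_range_zero, h0, twist_one, twist_two, twist_three,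
      ofBilin_add, ofBilin_smul]
    norm_num [Nat.factorial]
  · intro k hk
    by_contra h
    have h4 : 4 ≤ k := by simpa using h
    simp [T.twist_eq_zero _ h4] at hk

theorem isLeftDeformationMap_iff (B : T.A' →ₗ[K] T.A) : T.IsLeftDeformationMap B ↔ ∀ u v : T.A',
    T.π (B u) (B v) + T.ξ (B u) v + T.η u (B v) -
      B (T.β u v + T.ρ (B u) v + T.μ u (B v) + T.θ (B u) (B v)) = 0 := by
  simp only [IsLeftDeformationMap, sub_eq_zero]

end QuasiTwilled

theorem mainTheorem8 {K 𝒜 : Type*} [Field K] [CharZero K] [NonUnitalRing 𝒜] [Module K 𝒜]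
    [IsScalarTower K 𝒜 𝒜] [SMulCommClass K 𝒜 𝒜] (T : QuasiTwilled K 𝒜)
    (B : T.A' →ₗ[K] T.A) (hB : T.IsLeftDeformationMap B) (B' : T.A' →ₗ[K] T.A) :
    T.IsLeftDeformationMap (B + B') ↔
      IsMaurerCartan (twist T.l (ofLinear B)) (ofLinear B') := by
  rw [IsMaurerCartan, T.finsum_twist, ofBilin_eq_zero_iff, and_iff_right ⟨_, rfl⟩,
    T.isLeftDeformationMap_iff]
  rw [T.isLeftDeformationMap_iff] at hB
  refine forall₂_congr fun u v => ?_
  -- Subtract zero from Φ(B + B') at `(u, v)`, then rewrite that zero as Φ(B) at `(u, v)`. What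
  -- remains is the Taylor identity.
  refine Eq.congr_left ((sub_zero _).symm.trans ?_)
  rw [← hB u v]
  simp [QuasiTwilled.lOne, QuasiTwilled.lTwo, QuasiTwilled.lThree]
  -- The factors `1/2` and `1/6` cancel the repeated terms of `lTwo` and `lThree` at equal
  -- arguments; here characteristic `0` enters.
  module

end
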